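/- **Model.** For $\delta'>-1$, let $\mathrm{PA}_1(1,\delta')$ be a single vertex $v_1$ with one self-loop. Given $\mathrm{PA}_n(1,\delta')$ on $v_1,\dots,v_n$, with $D_i(n)$ the degree of $v_i$ (a loop counts twice), $\mathrm{PA}_{n+1}(1,\delta')$ is obtained by adding a vertex $v_{n+1}$ with a single edge, whose other end is $v_{n+1}$ itself with probability $\frac{1+\delta'}{n(2+\delta')+(1+\delta')}$ and is $v_i$, $1\le i\le n$, with probability $\frac{D_i(n)+\delta'}{n(2+\delta')+(1+\delta')}$. For an integer $m\ge 1$ and real $\delta>-m$, the random multigraph $\mathrm{PA}_t(m,\delta)$ on $[t]=\{1,\dots,t\}$ is obtained from $\mathrm{PA}_{mt}(1,\delta/m)$ by contracting, for each $i=1,\dots,t$, the vertices $v_{m(i-1)+1},\dots,v_{mi}$ into one vertex $i$, retaining all loops and multiple edges. Let $D_i(t)$ denote the degree of vertex $i$ in $\mathrm{PA}_t(m,\delta)$. **Lemma.** Let $m\ge 1$ be an integer, $\delta\ge 0$ and $A>0$ be constants. Put $\gamma=\frac{1}{2+\delta/m}$, $\omega=\omega(t)=A\log\log t$ and $\kappa_o=\kappa_o(t)=(\log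 t)^{999\,\omega}$. Then $$\Pr\left(D_i(t)\ \ge\ \left(\frac{t}{\kappa_o}\right)^{\gamma}\frac{1}{\kappa_o^{2}}\ \text{ for every integer } i \text{ with } 1\le i\le \kappa_o\right)\longrightarrow 1\qquad\text{as } t\to\infty .$$ -/

import Mathlib

open Filter Topology

noncomputable section

/-- A finite multigraph with vertices labelled by natural numbers; loops and parallel edges are
allowed. -/
structure Multigraph where
  /-- the vertex set -/
  verts : Finset ℕ
  /-- the edges, as unordered pairs of end points, with multiplicity -/
  edges : Multiset (Sym2 ℕ)

namespace Multigraph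

instance : MeasurableSpace Multigraph := ⊤

/-- The degree of `v`: each edge contributes the number of its ends at `v`, so a loop counts
twice. -/
def degree (G : Multigraph) (v : ℕ) : ℕ :=
  (G.edges.map fun e => e.toMultiset.count v).sum

/-- Identify all vertices with the same image under `f`; all loops and parallel edges that arise
are retained. -/
def contract (f : ℕ → ℕ) (G : Multigraph) : Multigraph where
  verts := G.verts.image f
  edges := G.edges.map (Sym2.map f)

/-- Add the vertex `u` together with a single edge joining it to `v`. -/
def addVertex (G : Multigraph) (u v : ℕ) : Multigraph where
  verts := insert u G.verts
  edges := s(u, v) ::ₘ G.edges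

theorem degree_addVertex (G : Multigraph) (u v w : ℕ) :
    (G.addVertex u v).degree w
      = ((if w = u then 1 else 0) + (if w = v then 1 else 0)) + G.degree w := by
  have h : (s(u, v)).toMultiset = u ::ₘ v ::ₘ 0 := rfl
  simp only [degree, addVertex, Multiset.map_cons, Multiset.sum_cons, h, Multiset.count_cons,
    Multiset.count_zero]
  ring

end Multigraph

/-- Multigraphs on the vertex set `{1, …, n}` with `n` edges and no isolated vertices. All states
of the process `PA_n(1, δ)` are of this kind. -/
structure PAState (n : ℕ) where
  graph : Multigraph
  verts_eq : graph.verts = Finset.Icc 1 n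
  ends_mem : ∀ e ∈ graph.edges, ∀ v ∈ e, v ∈ Finset.Icc 1 n
  card_edges : graph.edges.card = n
  one_le_degree : ∀ v ∈ Finset.Icc 1 n, 1 ≤ graph.degree v

namespace PAState

/-- The graph without vertices. -/
def empty : PAState 0 where
  graph := ⟨∅, 0⟩
  verts_eq := by simp
  ends_mem := by simp
  card_edges := by simp
  one_le_degree := by simp

/-- Add the vertex `n + 1`, whose edge goes to `v ∈ {1, …, n + 1}` (a loop if `v = n + 1`). -/
def grow {n : ℕ} (G : PAState n) (v : Finset.Icc 1 (n + 1)) : PAState (n + 1) where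
  graph := G.graph.addVertex (n + 1) v
  verts_eq := by
    ext w
    simp only [Multigraph.addVertex, G.verts_eq, Finset.mem_insert, Finset.mem_Icc]
    omega
  ends_mem := by
    intro e he w hw
    rcases Multiset.mem_cons.1 he with rfl | he
    · rcases Sym2.mem_iff.1 hw with rfl | rfl
      · simp
      · exact v.2
    · have := Finset.mem_Icc.1 (G.ends_mem e he w hw)
      exact Finset.mem_Icc.2 ⟨this.1, by omega⟩
  card_edges := by simp [Multigraph.addVertex, G.card_edges]
  one_le_degree := by
    intro w hw
    rw [Multigraph.degree_addVertex]
    by_cases h : w = n + 1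
    · simp [h]; omega
    · have := Finset.mem_Icc.1 hw
      have := G.one_le_degree w (Finset.mem_Icc.2 ⟨this.1, by omega⟩)
      omega

theorem sum_degree {n : ℕ} (G : PAState n) :
    ∑ v ∈ Finset.Icc 1 n, G.graph.degree v = 2 * n := by
  have key : ∀ s : Multiset (Sym2 ℕ), (∀ e ∈ s, ∀ v ∈ e, v ∈ Finset.Icc 1 n) →
      ∑ v ∈ Finset.Icc 1 n, (s.map fun e => e.toMultiset.count v).sum = 2 * s.card := by
    intro s
    induction s using Multiset.induction with
    | empty => simp
    | cons e s ih =>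
      intro h
      have h1 : ∑ v ∈ Finset.Icc 1 n, e.toMultiset.count v = 2 := by
        rw [Multiset.sum_count_eq_card, Sym2.card_toMultiset]
        intro a ha
        exact h e (Multiset.mem_cons_self e s) a (Sym2.mem_toMultiset.1 ha)
      simp only [Multiset.map_cons, Multiset.sum_cons, Finset.sum_add_distrib, Multiset.card_cons]
      rw [h1, ih fun e he => h e (Multiset.mem_cons_of_mem he)]
      ring
  simpa [Multigraph.degree, G.card_edges] using key G.graph.edges G.ends_mem

/-- The probability that the edge of the new vertex `n + 1` goes to `v`, given the graph `G` on
`{1, …, n}`. -/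
def attachProb {n : ℕ} (δ : ℝ) (G : PAState n) (v : ℕ) : ℝ :=
  if v = n + 1 then (1 + δ) / (n * (2 + δ) + (1 + δ))
  else (G.graph.degree v + δ) / (n * (2 + δ) + (1 + δ))

theorem attachProb_nonneg {n : ℕ} {δ : ℝ} (hδ : -1 < δ) (G : PAState n)
    (v : Finset.Icc 1 (n + 1)) : 0 ≤ attachProb δ G v := by
  have hd : 0 ≤ (n : ℝ) * (2 + δ) + (1 + δ) :=
    add_nonneg (mul_nonneg n.cast_nonneg (by linarith)) (by linarith)
  unfold attachProb
  split_ifs with h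
  · exact div_nonneg (by linarith) hd
  · have hv := Finset.mem_Icc.1 v.2
    have h1 := G.one_le_degree v (Finset.mem_Icc.2 ⟨hv.1, by omega⟩)
    have h2 : (1 : ℝ) ≤ G.graph.degree v := by exact_mod_cast h1
    exact div_nonneg (by linarith) hd

theorem sum_attachProb {n : ℕ} {δ : ℝ} (hδ : -1 < δ) (G : PAState n) :
    ∑ v : Finset.Icc 1 (n + 1), attachProb δ G v = 1 := by
  have hd : 0 < (n : ℝ) * (2 + δ) + (1 + δ) :=
    add_pos_of_nonneg_of_pos (mul_nonneg n.cast_nonneg (by linarith)) (by linarith)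
  rw [Finset.sum_coe_sort (Finset.Icc 1 (n + 1)) (attachProb δ G),
    Finset.sum_Icc_succ_top (by omega)]
  have h1 : ∑ v ∈ Finset.Icc 1 n, attachProb δ G v
      = ∑ v ∈ Finset.Icc 1 n, ((G.graph.degree v : ℝ) + δ) / (n * (2 + δ) + (1 + δ)) := by
    refine Finset.sum_congr rfl fun v hv => ?_
    have := Finset.mem_Icc.1 hv
    rw [attachProb, if_neg (by omega)]
  have h2 : ∑ v ∈ Finset.Icc 1 n, (G.graph.degree v : ℝ) = 2 * n := by
    exact_mod_cast G.sum_degree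
  rw [h1, ← Finset.sum_div, Finset.sum_add_distrib, h2, attachProb, if_pos rfl, ← add_div]
  rw [div_eq_one_iff_eq hd.ne']
  simp
  ring

/-- The conditional law of the vertex to which the new vertex `n + 1` attaches. -/
def attach {n : ℕ} (δ : ℝ) (hδ : -1 < δ) (G : PAState n) : PMF (Finset.Icc 1 (n + 1)) :=
  PMF.ofFintype (fun v => ENNReal.ofReal (attachProb δ G v)) (by
    rw [← ENNReal.ofReal_sum_of_nonneg fun v _ => attachProb_nonneg hδ G v, sum_attachProb hδ G,
      ENNReal.ofReal_one])

end PAState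

/-- The law of `PA_n(1, δ)`, for `δ > -1`. Since `attachProb δ empty 1 = 1`, the graph
`PA_1(1, δ)` is a single vertex with one loop. -/
def PAOne (δ : ℝ) (hδ : -1 < δ) : (n : ℕ) → PMF (PAState n)
  | 0 => PMF.pure PAState.empty
  | n + 1 => (PAOne δ hδ n).bind fun G => (G.attach δ hδ).map G.grow

theorem neg_one_lt_div {m : ℕ} (hm : 0 < m) {δ : ℝ} (hδ : -(m : ℝ) < δ) : -1 < δ / m := by
  rw [lt_div_iff₀ (by exact_mod_cast hm)]
  linarith

/-- The law of `PA_t(m, δ)`, for `m ≥ 1` and `δ > -m`: in `PA_{mt}(1, δ/m)` the vertices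
`m (i - 1) + 1, …, m i` are contracted to the vertex `i`, for each `i = 1, …, t`. -/
def PA (m : ℕ) (hm : 0 < m) (δ : ℝ) (hδ : -(m : ℝ) < δ) (t : ℕ) : PMF Multigraph :=
  (PAOne (δ / m) (neg_one_lt_div hm hδ) (m * t)).map
    fun G => G.graph.contract fun j => (j - 1) / m + 1

/-- `γ = 1 / (2 + δ / m)` -/
def paGamma (m : ℕ) (δ : ℝ) : ℝ := 1 / (2 + δ / m)

/-- `ω = A log log t` -/
def omegaRadius (A : ℝ) (t : ℕ) : ℝ := A * Real.log (Real.log t)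

/-- `κ_o = (log t)^(999 ω)` -/
def kappaOuter (A : ℝ) (t : ℕ) : ℝ := Real.log t ^ (999 * omegaRadius A t)

/-- The outer core `[κ_o] = {1, …, ⌊κ_o⌋}`. -/
def outerCore (A : ℝ) (t : ℕ) : Set ℕ := {i | 1 ≤ i ∧ (i : ℝ) ≤ kappaOuter A t}

end

/-!
Let `Z = n (2 + δ) + (1 + δ)`. In `PA_n(1, δ)` the new edge hits a nonempty set `W` of old vertices
with probability `(D_W + |W| δ) / Z`. For `0 ≤ s ≤ θ = |W| (1 + δ)`, the weight `(θ - s)_j / (θ)_j`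
at `j = D_W - |W|` loses exactly the fraction `s / (D_W + |W| δ)` of its value when this happens.
So each step multiplies its mean by `1 - s / Z`, and the mean decays like `n ^ (-s / (2 + δ))`.
For `s < θ` and `s ≤ 1` the weight is at least a constant times `D_W ^ (-s)`, and Markov's
inequality yields `P(D_W < y (n / k) ^ (1 / (2 + δ))) ≤ C y ^ s` when `W ⊆ {1, …, k}`.

The `m` vertices contracted to the vertex `i` of `PA_t(m, δ)` form such a set, with `θ = m + δ`, so
`P(D_i(t) < y (t / i) ^ γ) ≤ C y ^ s`. With `y = κ ^ (-2)` the union bound over `i ≤ κ` gives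
`C κ ^ (1 - 2 s)`, which tends to `0` as soon as `s > 1 / 2`.
-/

open scoped ENNReal

section PMFMean

variable {α β : Type*}

/-- The expectation of a `[0, ∞]`-valued function of a discrete random variable with law `p`. It is
written as a sum because `PAState n` carries no measurable structure. -/
noncomputable def pmfMean (p : PMF α) (f : α → ℝ≥0∞) : ℝ≥0∞ := ∑' a, p a * f a

theorem pmfMean_bind (p : PMF α) (g : α → PMF β) (f : β → ℝ≥0∞) :
    pmfMean (p.bind g) f = pmfMean p fun a => pmfMean (g a) f := by
  simp only [pmfMean, PMF.bind_apply, ← ENNReal.tsum_mul_right, ← ENNReal.tsum_mul_left, mul_assoc]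
  exact ENNReal.tsum_comm

theorem pmfMean_pure (a : α) (f : α → ℝ≥0∞) : pmfMean (PMF.pure a) f = f a := by
  rw [pmfMean, tsum_eq_single a fun b hb => by simp [PMF.pure_apply, hb]]
  simp

theorem pmfMean_map (p : PMF α) (g : α → β) (f : β → ℝ≥0∞) :
    pmfMean (p.map g) f = pmfMean p fun a => f (g a) := by
  simp only [← PMF.bind_pure_comp, pmfMean_bind, Function.comp_apply, pmfMean_pure]

theorem pmfMean_mono (p : PMF α) {f g : α → ℝ≥0∞} (h : ∀ a, f a ≤ g a) :
    pmfMean p f ≤ pmfMean p g :=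
  ENNReal.tsum_le_tsum fun a => mul_le_mul_right (h a) (p a)

theorem pmfMean_const_mul (p : PMF α) (c : ℝ≥0∞) (f : α → ℝ≥0∞) :
    pmfMean p (fun a => c * f a) = c * pmfMean p f := by
  simp only [pmfMean, mul_left_comm _ c, ENNReal.tsum_mul_left]

theorem pmfMean_const (p : PMF α) (c : ℝ≥0∞) : pmfMean p (fun _ => c) = c := by
  rw [pmfMean, ENNReal.tsum_mul_right, p.tsum_coe, one_mul]

theorem mul_toOuterMeasure_le_pmfMean (p : PMF α) (f : α → ℝ≥0∞) (c : ℝ≥0∞) {s : Set α}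
    (hs : ∀ a ∈ s, c ≤ f a) : c * p.toOuterMeasure s ≤ pmfMean p f := by
  rw [PMF.toOuterMeasure_apply, ← ENNReal.tsum_mul_left]
  refine ENNReal.tsum_le_tsum fun a => ?_
  by_cases ha : a ∈ s
  · simpa only [Set.indicator_of_mem ha, mul_comm c] using mul_le_mul_right (hs a ha) (p a)
  · simp only [Set.indicator_of_notMem ha, mul_zero, zero_le]

end PMFMean

/-- The ratio `(θ - s)_j / (θ)_j` of rising factorials, of order `j ^ (-s)`; it plays the role of
the `-s`-th power of the degree of a set of vertices, `j` being the excess of that degree over its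
least possible value. -/
noncomputable def risingRatio (s θ : ℝ) (j : ℕ) : ℝ := ∏ k ∈ Finset.range j, (1 - s / (θ + k))

section RisingRatio

variable {s θ : ℝ}

theorem risingRatio_zero (s θ : ℝ) : risingRatio s θ 0 = 1 := Finset.prod_range_zero _

theorem risingRatio_succ (s θ : ℝ) (j : ℕ) :
    risingRatio s θ (j + 1) = risingRatio s θ j * (1 - s / (θ + j)) :=
  Finset.prod_range_succ _ j

theorem one_sub_div_add_natCast_mem_Icc (hs : 0 ≤ s) (hsθ : s ≤ θ) (k : ℕ) :
    1 - s / (θ + k) ∈ Set.Icc (0 : ℝ) 1 := by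
  have : (0 : ℝ) ≤ k := k.cast_nonneg
  exact ⟨sub_nonneg.2 (div_le_one_of_le₀ (by linarith) (by linarith)),
    sub_le_self 1 (div_nonneg hs (by linarith))⟩

theorem risingRatio_nonneg (hs : 0 ≤ s) (hsθ : s ≤ θ) (j : ℕ) : 0 ≤ risingRatio s θ j :=
  Finset.prod_nonneg fun k _ => (one_sub_div_add_natCast_mem_Icc hs hsθ k).1

theorem risingRatio_le_one (hs : 0 ≤ s) (hsθ : s ≤ θ) (j : ℕ) : risingRatio s θ j ≤ 1 :=
  Finset.prod_le_one (fun k _ => (one_sub_div_add_natCast_mem_Icc hs hsθ k).1)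
    fun k _ => (one_sub_div_add_natCast_mem_Icc hs hsθ k).2

theorem div_add_one_rpow_le_one_sub_div (hs : 0 ≤ s) (hs1 : s ≤ 1) {x : ℝ} (hx : 0 < x) :
    (x / (x + 1)) ^ s ≤ 1 - s / (x + 1) := by
  have hx1 : 1 / (x + 1) ≤ 1 := (div_le_one (by linarith)).2 (by linarith)
  have bernoulli := rpow_one_add_le_one_add_mul_self (neg_le_neg hx1) hs hs1
  have hbase : 1 + -(1 / (x + 1)) = x / (x + 1) := by field_simp; ring
  rw [hbase] at bernoulli
  linarith [mul_one_div s (x + 1)]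

theorem mul_div_rpow_le_risingRatio_succ (hs : 0 ≤ s) (hs1 : s ≤ 1) (hsθ : s < θ) (j : ℕ) :
    (1 - s / θ) * (θ / (θ + j)) ^ s ≤ risingRatio s θ (j + 1) := by
  have hθ : 0 < θ := hs.trans_lt hsθ
  have : 0 ≤ 1 - s / θ := sub_nonneg.2 (div_le_one_of_le₀ hsθ.le hθ.le)
  induction j with
  | zero => simp [risingRatio_succ, risingRatio_zero, hθ.ne']
  | succ j ih =>
    have hj : 0 < θ + j := by positivity
    calc (1 - s / θ) * (θ / (θ + (j + 1 : ℕ))) ^ s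
        = (1 - s / θ) * (θ / (θ + j)) ^ s * ((θ + j) / (θ + j + 1)) ^ s := by
          rw [mul_assoc, ← Real.mul_rpow (by positivity) (by positivity),
            div_mul_div_cancel₀ hj.ne', Nat.cast_succ, add_assoc]
      _ ≤ risingRatio s θ (j + 1) * (1 - s / (θ + j + 1)) := by
          gcongr
          · exact risingRatio_nonneg hs hsθ.le _
          · exact div_add_one_rpow_le_one_sub_div hs hs1 hj
      _ = risingRatio s θ (j + 1 + 1) := by
          rw [risingRatio_succ _ _ (j + 1), Nat.cast_succ, add_assoc]

theorem exists_pos_mul_rpow_neg_le_risingRatio (hs : 0 ≤ s) (hs1 : s ≤ 1) (hsθ : s < θ) :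
    ∃ c > 0, ∀ j : ℕ, c * ((j : ℝ) + 1) ^ (-s) ≤ risingRatio s θ j := by
  have hθ : 0 < θ := hs.trans_lt hsθ
  have hc : 0 < 1 - s / θ := sub_pos.2 ((div_lt_one hθ).2 hsθ)
  refine ⟨(1 - s / θ) * (θ / (θ + 1)) ^ s, by positivity, fun j => ?_⟩
  have hle : θ / (θ + 1) * ((j : ℝ) + 1)⁻¹ ≤ θ / (θ + j) := by
    rw [← div_eq_mul_inv, div_div]
    gcongr
    nlinarith [mul_nonneg hθ.le (Nat.cast_nonneg (α := ℝ) j)]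
  calc (1 - s / θ) * (θ / (θ + 1)) ^ s * ((j : ℝ) + 1) ^ (-s)
      = (1 - s / θ) * (θ / (θ + 1) * ((j : ℝ) + 1)⁻¹) ^ s := by
        rw [Real.mul_rpow (by positivity) (by positivity), Real.inv_rpow (by positivity),
          Real.rpow_neg (by positivity), mul_assoc]
    _ ≤ (1 - s / θ) * (θ / (θ + j)) ^ s := by gcongr
    _ ≤ risingRatio s θ (j + 1) := mul_div_rpow_le_risingRatio_succ hs hs1 hsθ j
    _ ≤ risingRatio s θ j := by
        rw [risingRatio_succ]
        exact mul_le_of_le_one_right (risingRatio_nonneg hs hsθ.le j)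
          (one_sub_div_add_natCast_mem_Icc hs hsθ.le j).2

end RisingRatio

namespace Multigraph

/-- The total degree `D_W` of a set `W` of vertices. -/
def degreeSum (G : Multigraph) (W : Finset ℕ) : ℕ := ∑ w ∈ W, G.degree w

theorem degreeSum_eq_sum_edges (G : Multigraph) (W : Finset ℕ) :
    G.degreeSum W = (G.edges.map fun e => ∑ w ∈ W, e.toMultiset.count w).sum :=
  Multiset.sum_map_sum_map W.val G.edges

theorem toMultiset_sym2Map (f : ℕ → ℕ) (e : Sym2 ℕ) :
    (e.map f).toMultiset = e.toMultiset.map f := by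
  induction e with
  | _ a b => rfl

theorem sum_count_le_count_map {f : ℕ → ℕ} {W : Finset ℕ} {v : ℕ} (hf : ∀ w ∈ W, f w = v)
    (s : Multiset ℕ) : ∑ w ∈ W, s.count w ≤ (s.map f).count v := by
  induction s using Multiset.induction with
  | empty => simp
  | cons a s ih =>
    simp only [Multiset.map_cons, Multiset.count_cons, Finset.sum_add_distrib, Finset.sum_ite_eq']
    have := hf a
    split_ifs <;> grind

theorem degreeSum_le_degree_contract {f : ℕ → ℕ} {W : Finset ℕ} {v : ℕ}
    (hf : ∀ w ∈ W, f w = v) (G : Multigraph) : G.degreeSum W ≤ (G.contract f).degree v := by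
  rw [degreeSum_eq_sum_edges, degree, contract, Multiset.map_map]
  refine Multiset.sum_map_le_sum_map _ _ fun e _ => ?_
  rw [Function.comp_apply, toMultiset_sym2Map]
  exact sum_count_le_count_map hf _

end Multigraph

namespace PAState

variable {n : ℕ} {W : Finset ℕ}

theorem card_le_degreeSum (G : PAState n) (hW : W ⊆ Finset.Icc 1 n) :
    W.card ≤ G.graph.degreeSum W := by
  simpa [Multigraph.degreeSum] using
    Finset.card_nsmul_le_sum W G.graph.degree 1 fun w hw => G.one_le_degree w (hW hw)

theorem degreeSum_grow (G : PAState n) (hW : W ⊆ Finset.Icc 1 n) (v : Finset.Icc 1 (n + 1)) :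
    (G.grow v).graph.degreeSum W = G.graph.degreeSum W + if (v : ℕ) ∈ W then 1 else 0 := by
  have hnew : n + 1 ∉ W := fun h => by simpa using hW h
  simp [Multigraph.degreeSum, grow, Multigraph.degree_addVertex, Finset.sum_add_distrib, hnew,
    add_comm]

theorem sum_attachProb_of_subset (δ : ℝ) (G : PAState n) (hW : W ⊆ Finset.Icc 1 n) :
    ∑ w ∈ W, attachProb δ G w
      = (G.graph.degreeSum W + W.card * δ) / (n * (2 + δ) + (1 + δ)) := by
  have hold : ∀ w ∈ W, attachProb δ G w
      = (G.graph.degree w + δ) / (n * (2 + δ) + (1 + δ)) := fun w hw =>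
    if_neg (by have := Finset.mem_Icc.1 (hW hw); omega)
  rw [Finset.sum_congr rfl hold, ← Finset.sum_div, Finset.sum_add_distrib, Finset.sum_const,
    nsmul_eq_mul, Multigraph.degreeSum, Nat.cast_sum]

theorem sum_attachProb_mul_degreeSum_grow {δ : ℝ} (hδ : -1 < δ) (G : PAState n)
    (hW : W ⊆ Finset.Icc 1 n) (φ : ℕ → ℝ) :
    ∑ v : Finset.Icc 1 (n + 1), attachProb δ G v * φ ((G.grow v).graph.degreeSum W)
      = φ (G.graph.degreeSum W)
        + (G.graph.degreeSum W + W.card * δ) / (n * (2 + δ) + (1 + δ))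
          * (φ (G.graph.degreeSum W + 1) - φ (G.graph.degreeSum W)) := by
  set d := G.graph.degreeSum W with hd
  have hsplit : ∀ v : Finset.Icc 1 (n + 1),
      attachProb δ G v * φ ((G.grow v).graph.degreeSum W)
        = attachProb δ G v * φ d
          + (if (v : ℕ) ∈ W then attachProb δ G v else 0) * (φ (d + 1) - φ d) := by
    intro v
    rw [degreeSum_grow G hW, ← hd]
    split_ifs
    · ring
    · simp
  have hsub : W ⊆ Finset.Icc 1 (n + 1) :=
    hW.trans (Finset.Icc_subset_Icc_right n.le_succ)
  have hW_prob : ∑ v : Finset.Icc 1 (n + 1), (if (v : ℕ) ∈ W then attachProb δ G v else 0)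
      = ∑ w ∈ W, attachProb δ G w := by
    rw [Finset.sum_coe_sort (Finset.Icc 1 (n + 1)) fun v => if v ∈ W then attachProb δ G v else 0,
      Finset.sum_ite_mem, Finset.inter_eq_right.2 hsub]
  simp only [hsplit, Finset.sum_add_distrib, ← Finset.sum_mul, sum_attachProb hδ, hW_prob,
    sum_attachProb_of_subset δ G hW, one_mul, ← hd]

theorem sum_attachProb_mul_risingRatio {δ : ℝ} (hδ : -1 < δ) (G : PAState n)
    (hW : W ⊆ Finset.Icc 1 n) (hne : W.Nonempty) (s : ℝ) :
    ∑ v : Finset.Icc 1 (n + 1), attachProb δ G v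
        * risingRatio s (W.card * (1 + δ)) ((G.grow v).graph.degreeSum W - W.card)
      = (1 - s / (n * (2 + δ) + (1 + δ)))
        * risingRatio s (W.card * (1 + δ)) (G.graph.degreeSum W - W.card) := by
  obtain ⟨j, hj⟩ := Nat.exists_eq_add_of_le (G.card_le_degreeSum hW)
  have hcard : (0 : ℝ) < W.card := by exact_mod_cast hne.card_pos
  have hpos : 0 < (W.card : ℝ) * (1 + δ) + j :=
    add_pos_of_pos_of_nonneg (mul_pos hcard (by linarith)) j.cast_nonneg
  rw [sum_attachProb_mul_degreeSum_grow hδ G hW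
      fun d => risingRatio s (W.card * (1 + δ)) (d - W.card), hj, add_assoc,
    Nat.add_sub_cancel_left, Nat.add_sub_cancel_left, risingRatio_succ]
  have hθ : ((W.card + j : ℕ) : ℝ) + W.card * δ = W.card * (1 + δ) + j := by push_cast; ring
  rw [hθ]
  field_simp
  ring

theorem pmfMean_attach {δ : ℝ} (hδ : -1 < δ) (G : PAState n) {f : Finset.Icc 1 (n + 1) → ℝ}
    (hf : ∀ v, 0 ≤ f v) :
    pmfMean (G.attach δ hδ) (fun v => ENNReal.ofReal (f v))
      = ENNReal.ofReal (∑ v : Finset.Icc 1 (n + 1), attachProb δ G v * f v) := by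
  rw [pmfMean, tsum_fintype, ENNReal.ofReal_sum_of_nonneg fun v _ =>
    mul_nonneg (attachProb_nonneg hδ G v) (hf v)]
  exact Finset.sum_congr rfl fun v _ => (ENNReal.ofReal_mul (attachProb_nonneg hδ G v)).symm

end PAState

theorem one_sub_div_le_div_rpow {δ s : ℝ} (hδ : -1 < δ) (hs : 0 ≤ s) (n : ℕ) :
    1 - s / (n * (2 + δ) + (1 + δ)) ≤ (((n : ℝ) + 1) / (n + 2)) ^ (s / (2 + δ)) := by
  have hδ2 : 0 < 2 + δ := by linarith
  have hZ : 0 < n * (2 + δ) + (1 + δ) := by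
    have : 0 ≤ n * (2 + δ) := by positivity
    linarith
  have hrate : 1 / ((n : ℝ) + 1) * (s / (2 + δ)) ≤ s / (n * (2 + δ) + (1 + δ)) := by
    rw [one_div_mul_eq_div, div_div]
    gcongr
    linarith
  have hbase : Real.exp (-(1 / ((n : ℝ) + 1))) ≤ ((n : ℝ) + 1) / (n + 2) := by
    have := Real.add_one_le_exp (1 / ((n : ℝ) + 1))
    rw [Real.exp_neg, ← inv_div ((n : ℝ) + 2)]
    gcongr
    refine le_trans (le_of_eq ?_) this
    field_simp
    ring
  calc 1 - s / (n * (2 + δ) + (1 + δ)) ≤ 1 - 1 / ((n : ℝ) + 1) * (s / (2 + δ)) := by linarith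
    _ ≤ Real.exp (-(1 / ((n : ℝ) + 1) * (s / (2 + δ)))) := Real.one_sub_le_exp_neg _
    _ = Real.exp (-(1 / ((n : ℝ) + 1))) ^ (s / (2 + δ)) := by rw [← Real.exp_mul, neg_mul]
    _ ≤ (((n : ℝ) + 1) / (n + 2)) ^ (s / (2 + δ)) := by gcongr

section PAOne

variable {δ s : ℝ} {W : Finset ℕ} {k n : ℕ}

theorem pmfMean_PAOne_succ (hδ : -1 < δ) (f : PAState (n + 1) → ℝ≥0∞) :
    pmfMean (PAOne δ hδ (n + 1)) f
      = pmfMean (PAOne δ hδ n) fun G => pmfMean (G.attach δ hδ) fun v => f (G.grow v) := by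
  simp only [PAOne, pmfMean_bind, pmfMean_map]

theorem pmfMean_PAOne_succ_risingRatio (hδ : -1 < δ) (hs : 0 ≤ s) (hW : W ⊆ Finset.Icc 1 n)
    (hne : W.Nonempty) (hsW : s ≤ W.card * (1 + δ)) :
    pmfMean (PAOne δ hδ (n + 1)) (fun G => ENNReal.ofReal
        (risingRatio s (W.card * (1 + δ)) (G.graph.degreeSum W - W.card)))
      = ENNReal.ofReal (1 - s / (n * (2 + δ) + (1 + δ)))
        * pmfMean (PAOne δ hδ n) fun G => ENNReal.ofReal
            (risingRatio s (W.card * (1 + δ)) (G.graph.degreeSum W - W.card)) := by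
  rw [pmfMean_PAOne_succ, ← pmfMean_const_mul]
  congr 1 with G
  rw [G.pmfMean_attach hδ fun v => risingRatio_nonneg hs hsW _,
    G.sum_attachProb_mul_risingRatio hδ hW hne, ENNReal.ofReal_mul' (risingRatio_nonneg hs hsW _)]

theorem pmfMean_PAOne_risingRatio_le (hδ : -1 < δ) (hs : 0 ≤ s) (hW : W ⊆ Finset.Icc 1 k)
    (hne : W.Nonempty) (hsW : s ≤ W.card * (1 + δ)) (hkn : k ≤ n) :
    pmfMean (PAOne δ hδ n) (fun G => ENNReal.ofReal
        (risingRatio s (W.card * (1 + δ)) (G.graph.degreeSum W - W.card)))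
      ≤ ENNReal.ofReal ((((k : ℝ) + 1) / (n + 1)) ^ (s / (2 + δ))) := by
  induction n, hkn using Nat.le_induction with
  | base =>
    rw [div_self (by positivity), Real.one_rpow]
    exact (pmfMean_mono _ fun G => ENNReal.ofReal_le_ofReal (risingRatio_le_one hs hsW _)).trans_eq
      (pmfMean_const _ _)
  | succ n hkn ih =>
    have hWn : W ⊆ Finset.Icc 1 n := hW.trans (Finset.Icc_subset_Icc_right hkn)
    have hmerge : (((n : ℝ) + 1) / (n + 2)) ^ (s / (2 + δ))
          * (((k : ℝ) + 1) / (n + 1)) ^ (s / (2 + δ))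
        = (((k : ℝ) + 1) / ((n + 1 : ℕ) + 1)) ^ (s / (2 + δ)) := by
      rw [← Real.mul_rpow (by positivity) (by positivity)]
      congr 1
      push_cast
      field_simp
      ring
    rw [pmfMean_PAOne_succ_risingRatio hδ hs hWn hne hsW, ← hmerge,
      ENNReal.ofReal_mul (by positivity)]
    gcongr
    exact one_sub_div_le_div_rpow hδ hs n

theorem exists_pos_mul_degreeSum_rpow_neg_le_risingRatio {θ : ℝ} {a : ℕ} (ha : 0 < a)
    (hs : 0 ≤ s) (hs1 : s ≤ 1) (hsθ : s < θ) :
    ∃ c > 0, ∀ {n : ℕ} (G : PAState n) {W : Finset ℕ}, W.card = a → W ⊆ Finset.Icc 1 n →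
      c * (G.graph.degreeSum W : ℝ) ^ (-s) ≤ risingRatio s θ (G.graph.degreeSum W - a) := by
  obtain ⟨c, hc, hweight⟩ := exists_pos_mul_rpow_neg_le_risingRatio hs hs1 hsθ
  refine ⟨c, hc, ?_⟩
  rintro n G W rfl hW
  have hcard := G.card_le_degreeSum hW
  have hexcess : ((G.graph.degreeSum W - W.card : ℕ) : ℝ) + 1 ≤ G.graph.degreeSum W := by
    exact_mod_cast (by omega : G.graph.degreeSum W - W.card + 1 ≤ G.graph.degreeSum W)
  refine le_trans ?_ (hweight _)
  gcongr c * ?_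
  exact Real.rpow_le_rpow_of_nonpos (by positivity) hexcess (by linarith)

theorem exists_PAOne_degreeSum_lt_le (hδ : -1 < δ) {a : ℕ} (hs : 0 ≤ s) (hs1 : s ≤ 1)
    (hsa : s < a * (1 + δ)) :
    ∃ C : ℝ, 0 ≤ C ∧ ∀ {k n : ℕ} {W : Finset ℕ}, W.card = a → W ⊆ Finset.Icc 1 k → k ≤ n →
      ∀ {y : ℝ}, 0 < y →
      (PAOne δ hδ n).toOuterMeasure
          {G | (G.graph.degreeSum W : ℝ) < y * (((n : ℝ) + 1) / (k + 1)) ^ (1 / (2 + δ))}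
        ≤ ENNReal.ofReal (C * y ^ s) := by
  have ha : 0 < a := by
    refine Nat.pos_of_ne_zero fun h => hs.not_gt ?_
    simpa only [h, Nat.cast_zero, zero_mul] using hsa
  obtain ⟨c, hc, hweight⟩ := exists_pos_mul_degreeSum_rpow_neg_le_risingRatio ha hs hs1 hsa
  refine ⟨c⁻¹, by positivity, ?_⟩
  rintro k n W rfl hW hkn y hy
  have hWn : W ⊆ Finset.Icc 1 n := hW.trans (Finset.Icc_subset_Icc_right hkn)
  have hne : W.Nonempty := Finset.card_pos.1 ha
  set r : ℝ := (((n : ℝ) + 1) / (k + 1)) ^ (1 / (2 + δ)) with hr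
  have hr0 : 0 < r := by positivity
  have hlow : ∀ G ∈ {G : PAState n | (G.graph.degreeSum W : ℝ) < y * r},
      ENNReal.ofReal (c * (y * r) ^ (-s)) ≤ ENNReal.ofReal
        (risingRatio s (W.card * (1 + δ)) (G.graph.degreeSum W - W.card)) := by
    intro G hG
    have hpos : (0 : ℝ) < G.graph.degreeSum W := by
      exact_mod_cast ha.trans_le (G.card_le_degreeSum hWn)
    refine ENNReal.ofReal_le_ofReal (le_trans ?_ (hweight G rfl hWn))
    gcongr c * ?_
    exact Real.rpow_le_rpow_of_nonpos hpos (le_of_lt hG) (by linarith)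
  have hmarkov := (mul_toOuterMeasure_le_pmfMean (PAOne δ hδ n) _ _ hlow).trans
    (pmfMean_PAOne_risingRatio_le hδ hs hW hne hsa.le hkn)
  have hmean : (((k : ℝ) + 1) / (n + 1)) ^ (s / (2 + δ)) = r ^ (-s) := by
    rw [hr, ← Real.rpow_mul (by positivity), ← inv_div, Real.inv_rpow (by positivity),
      ← Real.rpow_neg (by positivity)]
    ring_nf
  have hquot : r ^ (-s) / (c * (y * r) ^ (-s)) = c⁻¹ * y ^ s := by
    rw [Real.mul_rpow hy.le hr0.le, Real.rpow_neg hy.le]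
    field_simp
  have hlow0 : 0 < c * (y * r) ^ (-s) := by positivity
  rw [← hquot, ENNReal.ofReal_div_of_pos hlow0, ← hmean]
  refine (ENNReal.le_div_iff_mul_le (.inl (by simpa using hlow0)) (.inl ENNReal.ofReal_ne_top)).2 ?_
  rwa [mul_comm]

end PAOne

section PA

variable {m : ℕ} {δ : ℝ}

theorem sub_one_div_add_one_eq {i w : ℕ} (hw : w ∈ Finset.Ioc (m * (i - 1)) (m * i)) :
    (w - 1) / m + 1 = i := by
  rw [Finset.mem_Ioc] at hw
  obtain ⟨j, rfl⟩ : ∃ j, i = j + 1 :=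
    Nat.exists_eq_succ_of_ne_zero (by rintro rfl; omega)
  rw [Nat.div_eq_of_lt_le (k := j) (by grind) (by grind)]

theorem PA_degree_lt_le_PAOne_degreeSum_lt (hm : 0 < m) (hδ : -(m : ℝ) < δ) (i t : ℕ) (x : ℝ) :
    (PA m hm δ hδ t).toMeasure {G | (G.degree i : ℝ) < x}
      ≤ (PAOne (δ / m) (neg_one_lt_div hm hδ) (m * t)).toOuterMeasure
          {G | (G.graph.degreeSum (Finset.Ioc (m * (i - 1)) (m * i)) : ℝ) < x} := by
  rw [PMF.toMeasure_apply_eq_toOuterMeasure_apply _ MeasurableSpace.measurableSet_top, PA,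
    PMF.toOuterMeasure_map_apply]
  refine MeasureTheory.measure_mono fun G hG => ?_
  have hle := G.graph.degreeSum_le_degree_contract fun w hw =>
    sub_one_div_add_one_eq (m := m) (i := i) hw
  exact (Nat.cast_le.2 hle).trans_lt (show _ < x from hG)

theorem div_le_two_mul_div_add_one {i t : ℕ} (hm : 0 < m) (hi : 1 ≤ i) :
    (t : ℝ) / i ≤ 2 * (((m * t : ℕ) + 1) / ((m * i : ℕ) + 1)) := by
  have hm' : (1 : ℝ) ≤ m := by exact_mod_cast hm
  have hi' : (1 : ℝ) ≤ i := by exact_mod_cast hi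
  have hmi : (1 : ℝ) ≤ m * i := one_le_mul_of_one_le_of_one_le hm' hi'
  have ht : (0 : ℝ) ≤ t := t.cast_nonneg
  push_cast
  rw [← mul_div_assoc, div_le_div_iff₀ (by linarith) (by linarith)]
  nlinarith [mul_le_mul_of_nonneg_left hmi ht]

theorem exists_PA_degree_lt_le (hm : 0 < m) (hδ : -(m : ℝ) < δ) {s : ℝ} (hs : 0 ≤ s)
    (hs1 : s ≤ 1) (hsm : s < m + δ) :
    ∃ C : ℝ, 0 ≤ C ∧ ∀ {i t : ℕ}, 1 ≤ i → i ≤ t → ∀ {y : ℝ}, 0 < y →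
      (PA m hm δ hδ t).toMeasure {G | (G.degree i : ℝ) < y * ((t : ℝ) / i) ^ paGamma m δ}
        ≤ ENNReal.ofReal (C * y ^ s) := by
  have hm' : (0 : ℝ) < m := by exact_mod_cast hm
  have hδ' := neg_one_lt_div hm hδ
  have hsm' : s < m * (1 + δ / m) := by rwa [mul_add, mul_one, mul_div_cancel₀ _ hm'.ne']
  have hγ : 0 ≤ paGamma m δ := one_div_nonneg.2 (by linarith)
  obtain ⟨C, hC, htail⟩ := exists_PAOne_degreeSum_lt_le hδ' hs hs1 hsm'
  refine ⟨C * (2 ^ paGamma m δ) ^ s, by positivity, fun {i t} hi hit {y} hy => ?_⟩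
  have hcard : (Finset.Ioc (m * (i - 1)) (m * i)).card = m := by
    rw [Nat.card_Ioc, ← Nat.mul_sub, Nat.sub_sub_self hi, mul_one]
  have hblock : Finset.Ioc (m * (i - 1)) (m * i) ⊆ Finset.Icc 1 (m * i) := fun w hw => by
    rw [Finset.mem_Ioc] at hw
    exact Finset.mem_Icc.2 ⟨by omega, hw.2⟩
  have hscale : y * ((t : ℝ) / i) ^ paGamma m δ
      ≤ y * 2 ^ paGamma m δ * (((m * t : ℕ) + 1 : ℝ) / ((m * i : ℕ) + 1)) ^ paGamma m δ := by
    rw [mul_assoc, ← Real.mul_rpow (by positivity) (by positivity)]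
    gcongr
    exact div_le_two_mul_div_add_one hm hi
  calc (PA m hm δ hδ t).toMeasure {G | (G.degree i : ℝ) < y * ((t : ℝ) / i) ^ paGamma m δ}
      ≤ _ := PA_degree_lt_le_PAOne_degreeSum_lt hm hδ i t _
    _ ≤ (PAOne (δ / m) hδ' (m * t)).toOuterMeasure
          {G | (G.graph.degreeSum (Finset.Ioc (m * (i - 1)) (m * i)) : ℝ)
            < y * 2 ^ paGamma m δ
              * (((m * t : ℕ) + 1 : ℝ) / ((m * i : ℕ) + 1)) ^ paGamma m δ} :=
        MeasureTheory.measure_mono fun G hG => lt_of_lt_of_le hG hscale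
    _ ≤ ENNReal.ofReal (C * (y * 2 ^ paGamma m δ) ^ s) :=
        htail hcard hblock (Nat.mul_le_mul_left m hit) (by positivity)
    _ = ENNReal.ofReal (C * (2 ^ paGamma m δ) ^ s * y ^ s) := by
        rw [Real.mul_rpow hy.le (by positivity), mul_assoc, mul_comm (y ^ s)]

theorem exists_PA_exists_degree_lt_le (hm : 0 < m) (hδ : -(m : ℝ) < δ) {s : ℝ} (hs : 0 ≤ s)
    (hs1 : s ≤ 1) (hsm : s < m + δ) :
    ∃ C : ℝ, ∀ {t : ℕ} {κ y : ℝ}, 0 < κ → κ ≤ t → 0 < y →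
      (PA m hm δ hδ t).toMeasure {G | ∃ i : ℕ, (1 ≤ i ∧ (i : ℝ) ≤ κ) ∧
          (G.degree i : ℝ) < y * ((t : ℝ) / κ) ^ paGamma m δ}
        ≤ ENNReal.ofReal (C * (κ * y ^ s)) := by
  obtain ⟨C, hC, htail⟩ := exists_PA_degree_lt_le hm hδ hs hs1 hsm
  have hγ : 0 ≤ paGamma m δ := one_div_nonneg.2 (by linarith [neg_one_lt_div hm hδ])
  refine ⟨C, fun {t κ y} hκ hκt hy => ?_⟩
  set x : ℝ := y * ((t : ℝ) / κ) ^ paGamma m δ with hx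
  have hvertex : ∀ i ∈ Finset.Icc 1 ⌊κ⌋₊,
      (PA m hm δ hδ t).toMeasure {G | (G.degree i : ℝ) < x} ≤ ENNReal.ofReal (C * y ^ s) := by
    intro i hi
    rw [Finset.mem_Icc, Nat.le_floor_iff hκ.le] at hi
    have hi0 : (0 : ℝ) < i := by exact_mod_cast hi.1
    have hxi : x ≤ y * ((t : ℝ) / i) ^ paGamma m δ := by
      rw [hx]
      gcongr
      exact hi.2
    exact (MeasureTheory.measure_mono fun G hG => lt_of_lt_of_le hG hxi).trans
      (htail hi.1 (by exact_mod_cast hi.2.trans hκt) hy)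
  have hunion : {G : Multigraph | ∃ i : ℕ, (1 ≤ i ∧ (i : ℝ) ≤ κ) ∧ (G.degree i : ℝ) < x}
      ⊆ ⋃ i ∈ Finset.Icc 1 ⌊κ⌋₊, {G | (G.degree i : ℝ) < x} := by
    rintro G ⟨i, ⟨hi, hiκ⟩, hdeg⟩
    exact Set.mem_biUnion (Finset.mem_coe.2 (Finset.mem_Icc.2 ⟨hi, Nat.le_floor hiκ⟩)) hdeg
  calc (PA m hm δ hδ t).toMeasure {G | ∃ i : ℕ, (1 ≤ i ∧ (i : ℝ) ≤ κ) ∧ (G.degree i : ℝ) < x}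
      ≤ ∑ i ∈ Finset.Icc 1 ⌊κ⌋₊, (PA m hm δ hδ t).toMeasure {G | (G.degree i : ℝ) < x} :=
        (MeasureTheory.measure_mono hunion).trans (MeasureTheory.measure_biUnion_finset_le _ _)
    _ ≤ ∑ _i ∈ Finset.Icc 1 ⌊κ⌋₊, ENNReal.ofReal (C * y ^ s) := Finset.sum_le_sum hvertex
    _ = ENNReal.ofReal (⌊κ⌋₊ * (C * y ^ s)) := by
        rw [Finset.sum_const, Nat.card_Icc, Nat.add_sub_cancel, nsmul_eq_mul,
          ENNReal.ofReal_mul (Nat.cast_nonneg _), ENNReal.ofReal_natCast]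
    _ ≤ ENNReal.ofReal (C * (κ * y ^ s)) := by
        rw [mul_left_comm C]
        gcongr
        exact Nat.floor_le hκ.le

end PA

theorem tendsto_mul_inv_sq_rpow {s : ℝ} (hs : 1 / 2 < s) :
    Tendsto (fun κ : ℝ => κ * (κ ^ 2)⁻¹ ^ s) atTop (𝓝 0) := by
  refine (tendsto_rpow_neg_atTop (by linarith : 0 < 2 * s - 1)).congr' ?_
  filter_upwards [eventually_gt_atTop 0] with κ hκ
  rw [Real.inv_rpow (by positivity), ← Real.rpow_natCast_mul hκ.le, ← div_eq_mul_inv,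
    neg_sub, Real.rpow_sub hκ, Real.rpow_one, Nat.cast_ofNat]

section KappaOuter

theorem tendsto_log_natCast_atTop : Tendsto (fun t : ℕ => Real.log t) atTop atTop :=
  Real.tendsto_log_atTop.comp tendsto_natCast_atTop_atTop

theorem kappaOuter_eventuallyEq_exp (A : ℝ) :
    kappaOuter A =ᶠ[atTop] fun t => Real.exp (999 * A * Real.log (Real.log t) ^ 2) := by
  filter_upwards [tendsto_log_natCast_atTop.eventually_gt_atTop 0] with t ht
  rw [kappaOuter, omegaRadius, Real.rpow_def_of_pos ht]
  ring_nf

theorem tendsto_kappaOuter_atTop {A : ℝ} (hA : 0 < A) : Tendsto (kappaOuter A) atTop atTop := by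
  have hloglog := Real.tendsto_log_atTop.comp tendsto_log_natCast_atTop
  have hexp := ((tendsto_pow_atTop two_ne_zero).comp hloglog).const_mul_atTop
    (by positivity : 0 < 999 * A)
  exact (Real.tendsto_exp_atTop.comp hexp).congr' (kappaOuter_eventuallyEq_exp A).symm

theorem eventually_kappaOuter_le_natCast (A : ℝ) : ∀ᶠ t : ℕ in atTop, kappaOuter A t ≤ t := by
  have hlittleO : (fun x : ℝ => 999 * A * Real.log x ^ 2) =o[atTop] fun x => x :=
    (Real.isLittleO_pow_log_id_atTop (n := 2)).const_mul_left (999 * A)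
  filter_upwards [kappaOuter_eventuallyEq_exp A, eventually_gt_atTop 0,
    tendsto_log_natCast_atTop.eventually_ge_atTop 0,
    tendsto_log_natCast_atTop.eventually (hlittleO.bound one_pos)] with t hκ ht hlog hle
  rw [hκ, ← Real.le_log_iff_exp_le (by exact_mod_cast ht)]
  rw [one_mul, Real.norm_of_nonneg hlog] at hle
  exact (Real.le_norm_self _).trans hle

end KappaOuter

theorem mainTheorem5_general {m : ℕ} (hm : 0 < m) {δ : ℝ} (hδ : -(m : ℝ) < δ)
    (hmδ : 1 / 2 < m + δ) {κ : ℕ → ℝ} (hκ : Tendsto κ atTop atTop) (hκt : ∀ᶠ t in atTop, κ t ≤ t) :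
    Tendsto
      (fun t : ℕ => (PA m hm δ hδ t).toMeasure
        {G | ∀ i : ℕ, 1 ≤ i ∧ (i : ℝ) ≤ κ t →
          ((t : ℝ) / κ t) ^ paGamma m δ / κ t ^ 2 ≤ (G.degree i : ℝ)})
      atTop (𝓝 1) := by
  obtain ⟨s, hs, hs'⟩ := exists_between (lt_min one_half_lt_one hmδ)
  obtain ⟨hs1, hsm⟩ := lt_min_iff.1 hs'
  obtain ⟨C, hC⟩ := exists_PA_exists_degree_lt_le hm hδ (by linarith) hs1.le hsm
  have hbound : Tendsto (fun t => ENNReal.ofReal (C * (κ t * (κ t ^ 2)⁻¹ ^ s))) atTop (𝓝 0) := by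
    simpa using ENNReal.tendsto_ofReal (((tendsto_mul_inv_sq_rpow hs).comp hκ).const_mul C)
  have hfail : Tendsto (fun t : ℕ => (PA m hm δ hδ t).toMeasure
      {G | ∃ i : ℕ, (1 ≤ i ∧ (i : ℝ) ≤ κ t) ∧
        (G.degree i : ℝ) < (κ t ^ 2)⁻¹ * ((t : ℝ) / κ t) ^ paGamma m δ}) atTop (𝓝 0) := by
    refine tendsto_of_tendsto_of_tendsto_of_le_of_le' tendsto_const_nhds hbound
      (.of_forall fun _ => zero_le) ?_
    filter_upwards [hκ.eventually_gt_atTop 0, hκt] with t hpos hle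
      using hC hpos hle (by positivity)
  have hsub := ENNReal.Tendsto.sub (tendsto_const_nhds (x := 1)) hfail (.inl ENNReal.one_ne_top)
  rw [tsub_zero] at hsub
  refine hsub.congr fun t => ?_
  rw [← MeasureTheory.prob_compl_eq_one_sub MeasurableSpace.measurableSet_top]
  congr 1
  ext G
  simp [div_eq_inv_mul]

theorem mainTheorem5 (m : ℕ) (hm : 0 < m) (δ : ℝ) (hδ : -(m : ℝ) < δ) (hδ0 : 0 ≤ δ)
    (A : ℝ) (hA : 0 < A) :
    Tendsto
      (fun t : ℕ => (PA m hm δ hδ t).toMeasure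
        {G | ∀ i ∈ outerCore A t,
          ((t : ℝ) / kappaOuter A t) ^ paGamma m δ / kappaOuter A t ^ 2 ≤ (G.degree i : ℝ)})
      atTop (𝓝 1) := by
  have hm1 : (1 : ℝ) ≤ m := by exact_mod_cast hm
  exact mainTheorem5_general hm hδ (by linarith) (tendsto_kappaOuter_atTop hA)
    (eventually_kappaOuter_le_natCast A)
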